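/- Let $X$ be a finite-dimensional real or complex inner product space. If $V, W \subset X$ are nonzero subspaces with $p = \dim V$, $q = \dim W$ and $m = \min\{p,q\}$, there are orthonormal bases $(e_1,\dots,e_p)$ of $V$ and $(f_1,\dots,f_q)$ of $W$ and numbers $0 \le \theta_1 \le \dots \le \theta_m \le \frac{\pi}{2}$ such that $\langle e_i, f_j\rangle = \delta_{ij}\cos\theta_i$ for all $i,j$ (so $\langle e_i,f_j\rangle=0$ for $i\ne j$); the $\theta_i$ are uniquely determined and are called the principal angles of $V$ and $W$. The (asymmetric) Grassmann angle $\Theta_{V,W} \in [0,\frac{\pi}{2}]$ of $V$ with $W$ is \[ \Theta_{V,W} = \begin{cases} \arccos(\cos\theta_1 \cdots \cos\theta_m) & \text{if } \dim V \le \dim W, \\ \frac{\pi}{2} & \text{if } \dim V > \dim W, \end{cases} \] for nonzero $V, W$; moreover $\Theta_{\{0\},W} = 0$ for every subspace $W$ (including $W=\{0\}$), and $\Theta_{V,\{0\}} = \frac{\pi}{2}$ for $V \neq \{0\}$. **Theorem.** For any subspaces $U, V, W \subset X$, of possibly different dimensions, \[ \Theta_{U,W} \le \Theta_{U,V} + \Theta_{V,W}.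 \] -/

import Mathlib

namespace Submodule

variable {𝕜 X : Type*} [RCLike 𝕜] [NormedAddCommGroup X] [InnerProductSpace 𝕜 X]
  [FiniteDimensional 𝕜 X]

/-- `e` and `f` are associated principal bases of the subspaces `V` and `W` (`e` an orthonormal
basis of `V`, `f` an orthonormal basis of `W`), with principal angles
`0 ≤ θ 0 ≤ θ 1 ≤ ⋯ ≤ π / 2`, as many as the smaller of the two dimensions:
`⟪e i, f j⟫ = δ i j * cos (θ i)`. -/
structure IsPrincipalSystem (V W : Submodule 𝕜 X)
    (e : OrthonormalBasis (Fin (Module.finrank 𝕜 V)) 𝕜 V)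
    (f : OrthonormalBasis (Fin (Module.finrank 𝕜 W)) 𝕜 W)
    (θ : Fin (min (Module.finrank 𝕜 V) (Module.finrank 𝕜 W)) → ℝ) : Prop where
  mono : Monotone θ
  mem_Icc : ∀ i, θ i ∈ Set.Icc 0 (Real.pi / 2)
  inner_eq : ∀ (i : Fin (Module.finrank 𝕜 V)) (j : Fin (Module.finrank 𝕜 W)),
    inner 𝕜 (e i : X) (f j : X) =
      if h : (i : ℕ) = j then
        ((Real.cos (θ ⟨i, lt_min i.isLt (h ▸ j.isLt)⟩) : ℝ) : 𝕜)
      else 0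

/-- Principal bases and angles exist, for any two subspaces. -/
theorem exists_isPrincipalSystem (V W : Submodule 𝕜 X) : ∃ θ e f, IsPrincipalSystem V W e f θ := by
  set P : V →ₗ[𝕜] W := (W.orthogonalProjectionOnto : X →ₗ[𝕜] W) ∘ₗ V.subtype with hP
  have hPin : ∀ (v : V) (w : W), inner 𝕜 (P v) w = inner 𝕜 (v : X) (w : X) := by
    intro v w
    simp [hP]
  set σ : ℕ → ℝ := fun i => P.singularValues i with hσ
  set e : OrthonormalBasis (Fin (Module.finrank 𝕜 V)) 𝕜 V :=
    P.isSymmetric_adjoint_comp_self.eigenvectorBasis rfl with he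
  have hPP : ∀ i j, inner 𝕜 (P (e i)) (P (e j)) =
      if i = j then ((σ i ^ 2 : ℝ) : 𝕜) else 0 := by
    intro i j
    have h1 : (LinearMap.adjoint P ∘ₗ P) (e j) = ((σ j ^ 2 : ℝ) : 𝕜) • e j := by
      rw [hσ]
      simp only
      rw [P.sq_singularValues_fin rfl j]
      exact P.isSymmetric_adjoint_comp_self.apply_eigenvectorBasis rfl j
    rw [← LinearMap.adjoint_inner_right]
    rw [LinearMap.comp_apply] at h1
    rw [h1, inner_smul_right, orthonormal_iff_ite.mp e.orthonormal i j]
    split_ifs with h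
    · subst h; simp
    · simp
  have hrank : ∀ i, σ i ≠ 0 → i < Module.finrank 𝕜 W := by
    intro i hi
    have h1 : i < Module.finrank 𝕜 (LinearMap.range P) := by
      rw [← P.singularValues_pos_iff_lt_finrank_range]
      exact lt_of_le_of_ne (P.singularValues_nonneg i) (Ne.symm hi)
    exact h1.trans_le (Submodule.finrank_le _)
  have hrankV : ∀ i, σ i ≠ 0 → i < Module.finrank 𝕜 V := by
    intro i hi
    by_contra h
    exact hi (P.singularValues_of_finrank_le (not_lt.mp h))
  let v : Fin (Module.finrank 𝕜 W) → W := fun j =>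
    if h : (j : ℕ) < Module.finrank 𝕜 V then ((σ j : 𝕜)⁻¹) • P (e ⟨j, h⟩) else 0
  let s : Set (Fin (Module.finrank 𝕜 W)) := {j | σ j ≠ 0}
  have hv : Orthonormal 𝕜 (s.domRestrict v) := by
    rw [orthonormal_iff_ite]
    rintro ⟨i, hi⟩ ⟨j, hj⟩
    have hi' : (σ i : 𝕜) ≠ 0 := by exact_mod_cast hi
    simp only [Set.domRestrict_apply, v, dif_pos (hrankV _ hi), dif_pos (hrankV _ hj),
      inner_smul_left, inner_smul_right, hPP, Subtype.mk.injEq, Fin.mk.injEq, Fin.val_inj]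
    split_ifs with h
    · subst h
      rw [map_inv₀, RCLike.conj_ofReal]
      push_cast
      field_simp
    · simp
  obtain ⟨f, hf⟩ := hv.exists_orthonormalBasis_extension_of_card_eq (by simp)
  have hle : ∀ i, σ i ≤ 1 := by
    intro i
    by_cases h : i < Module.finrank 𝕜 V
    · have h1 := hPP ⟨i, h⟩ ⟨i, h⟩
      rw [if_pos rfl, inner_self_eq_norm_sq_to_K] at h1
      have h2 : ‖P (e ⟨i, h⟩)‖ ^ 2 = σ i ^ 2 := by exact_mod_cast h1
      have h3 : ‖P (e ⟨i, h⟩)‖ ≤ 1 := by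
        have h4 : ‖P (e ⟨i, h⟩)‖ ≤ ‖((e ⟨i, h⟩ : V) : X)‖ := by
          simpa [hP] using W.norm_orthogonalProjectionOnto_apply_le ((e ⟨i, h⟩ : V) : X)
        have h5 : ‖((e ⟨i, h⟩ : V) : X)‖ = 1 := e.orthonormal.1 ⟨i, h⟩
        rwa [h5] at h4
      nlinarith [norm_nonneg (P (e ⟨i, h⟩)), P.singularValues_nonneg i]
    · have : σ i = 0 := P.singularValues_of_finrank_le (not_lt.mp h)
      rw [this]; exact zero_le_one
  have hnn : ∀ i, 0 ≤ σ i := fun i => P.singularValues_nonneg i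
  refine ⟨fun i => Real.arccos (σ i), e, f, ?_, ?_, ?_⟩
  · intro i j hij
    exact Real.antitone_arccos (P.singularValues_antitone hij)
  · intro i
    exact ⟨Real.arccos_nonneg _, Real.arccos_le_pi_div_two.mpr (hnn i)⟩
  · intro i j
    have hcos : ∀ n, Real.cos (Real.arccos (σ n)) = σ n := fun n =>
      Real.cos_arccos (by linarith [hnn n]) (hle n)
    rw [← hPin]
    simp only [hcos]
    by_cases hi : σ i = 0
    · have h1 : P (e i) = 0 := by
        have h2 := hPP i i
        rw [if_pos rfl, hi] at h2
        rw [← inner_self_eq_zero (𝕜 := 𝕜), h2]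
        simp
      rw [h1, hi]
      simp
    · have hfi : f ⟨i, hrank i hi⟩ = ((σ i : 𝕜)⁻¹) • P (e i) := by
        rw [hf ⟨i, hrank i hi⟩ hi]
        simp [v]
      have hi' : (σ i : 𝕜) ≠ 0 := by exact_mod_cast hi
      have hPe : P (e i) = (σ i : 𝕜) • f ⟨i, hrank i hi⟩ := by
        rw [hfi, smul_smul, mul_inv_cancel₀ hi', one_smul]
      rw [hPe, inner_smul_left, orthonormal_iff_ite.mp f.orthonormal, RCLike.conj_ofReal]
      simp only [Fin.ext_iff]
      split_ifs <;> simp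

/-- The principal angles do not depend on the principal bases: their cosines are the singular
values of the orthogonal projection `V → W`. -/
theorem IsPrincipalSystem.cos_eq {V W : Submodule 𝕜 X} {e f θ} (h : IsPrincipalSystem V W e f θ) (i) :
    Real.cos (θ i) =
      ((W.orthogonalProjectionOnto : X →ₗ[𝕜] W) ∘ₗ V.subtype : V →ₗ[𝕜] W).singularValues i := by
  set P : V →ₗ[𝕜] W := (W.orthogonalProjectionOnto : X →ₗ[𝕜] W) ∘ₗ V.subtype with hP
  have hPin : ∀ (v : V) (w : W), inner 𝕜 (P v) w = inner 𝕜 (v : X) (w : X) := by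
    intro v w
    simp [hP]
  let c : Fin (Module.finrank 𝕜 V) → ℝ := fun i =>
    if hi : (i : ℕ) < Module.finrank 𝕜 W then Real.cos (θ ⟨i, lt_min i.isLt hi⟩) else 0
  have hc0 : ∀ i, 0 ≤ c i := by
    intro i
    simp only [c]
    split_ifs with hi
    · have := h.mem_Icc ⟨i, lt_min i.isLt hi⟩
      exact Real.cos_nonneg_of_mem_Icc ⟨by linarith [this.1, Real.pi_pos], this.2⟩
    · exact le_rfl
  have hc : Antitone c := by
    intro i j hij
    by_cases hj : (j : ℕ) < Module.finrank 𝕜 W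
    · have hi : (i : ℕ) < Module.finrank 𝕜 W := lt_of_le_of_lt hij hj
      simp only [c, dif_pos hi, dif_pos hj]
      have h1 := h.mem_Icc ⟨i, lt_min i.isLt hi⟩
      have h2 := h.mem_Icc ⟨j, lt_min j.isLt hj⟩
      exact Real.cos_le_cos_of_nonneg_of_le_pi h1.1 (by linarith [h2.2, Real.pi_pos])
        (h.mono hij)
    · have : c j = 0 := by simp only [c, dif_neg hj]
      rw [this]
      exact hc0 i
  have hPe : ∀ i j, inner 𝕜 (P (e i)) (f j) = if (i : ℕ) = j then (c i : 𝕜) else 0 := by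
    intro i j
    rw [hPin, h.inner_eq]
    by_cases hij : (i : ℕ) = j
    · rw [dif_pos hij, if_pos hij]
      simp only [c, dif_pos (hij ▸ j.isLt : (i : ℕ) < Module.finrank 𝕜 W)]
    · rw [dif_neg hij, if_neg hij]
  have hPP : ∀ i j, inner 𝕜 (P (e i)) (P (e j)) = if i = j then ((c i ^ 2 : ℝ) : 𝕜) else 0 := by
    intro i j
    rw [← f.sum_inner_mul_inner]
    have h1 : ∀ k, inner 𝕜 (f k) (P (e j)) = if (j : ℕ) = k then (c j : 𝕜) else 0 := by
      intro k
      rw [← inner_conj_symm, hPe]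
      split_ifs <;> simp
    simp only [hPe, h1]
    by_cases hi : (i : ℕ) < Module.finrank 𝕜 W
    · rw [Finset.sum_eq_single ⟨i, hi⟩]
      · by_cases hij : i = j
        · subst hij; simp [sq]
        · have : ¬ (j : ℕ) = i := fun hh => hij (Fin.ext hh.symm)
          simp [hij, this]
      · intro k _ hk
        have : ¬ (i : ℕ) = k := fun hh => hk (Fin.ext hh.symm)
        simp [this]
      · simp
    · rw [Finset.sum_eq_zero]
      · have : c i = 0 := by simp only [c, dif_neg hi]
        simp [this]
      · intro k _
        have : ¬ (i : ℕ) = k := fun hh => hi (hh ▸ k.isLt)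
        simp [this]
  set T := LinearMap.adjoint P ∘ₗ P with hT
  have hmat : T.toMatrix e.toBasis e.toBasis = Matrix.diagonal (fun i => ((c i ^ 2 : ℝ) : 𝕜)) := by
    ext i j
    rw [LinearMap.toMatrix_apply, OrthonormalBasis.coe_toBasis,
      OrthonormalBasis.coe_toBasis_repr_apply, OrthonormalBasis.repr_apply_apply, hT,
      LinearMap.comp_apply, LinearMap.adjoint_inner_right, hPP, Matrix.diagonal_apply]
  have haux : ∀ g : Fin (Module.finrank 𝕜 V) → 𝕜,
      (∏ i, (Polynomial.X - Polynomial.C (g i))).roots = Multiset.map g Finset.univ.val := by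
    intro g
    rw [Polynomial.roots_prod _ _ (by
      simp [Finset.prod_ne_zero_iff, Polynomial.X_sub_C_ne_zero])]
    simp
  have hroots : T.charpoly.roots = Multiset.map (fun i => ((c i ^ 2 : ℝ) : 𝕜)) Finset.univ.val := by
    rw [← LinearMap.charpoly_toMatrix _ e.toBasis, hmat, Matrix.charpoly_diagonal]
    exact haux _
  have hsort : (T.charpoly.roots.map RCLike.re).sort (· ≥ ·) = List.ofFn (fun i => c i ^ 2) := by
    simp_rw [hroots, Fin.univ_val_map, Multiset.map_coe, List.map_ofFn,
      Function.comp_def, RCLike.ofReal_re, Multiset.coe_sort]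
    apply List.mergeSort_of_pairwise
    simp_rw [decide_eq_true_eq, ← List.sortedGE_iff_pairwise]
    have hcc : Antitone (fun i => c i ^ 2) := fun i j hij => pow_le_pow_left₀ (hc0 j) (hc hij) 2
    exact hcc.sortedGE_ofFn
  rw [P.isSymmetric_adjoint_comp_self.sort_roots_charpoly_eq_eigenvalues rfl, List.ofFn_inj]
    at hsort
  have hiV : (i : ℕ) < Module.finrank 𝕜 V := lt_of_lt_of_le i.isLt (min_le_left _ _)
  have hiW : (i : ℕ) < Module.finrank 𝕜 W := lt_of_lt_of_le i.isLt (min_le_right _ _)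
  have hfin := P.sq_singularValues_fin rfl ⟨i, hiV⟩
  rw [hsort] at hfin
  have hci : c ⟨i, hiV⟩ = Real.cos (θ i) := by simp only [c, dif_pos hiW]
  rw [← hci]
  exact ((sq_eq_sq₀ (P.singularValues_nonneg i) (hc0 _)).mp hfin).symm

/-- The principal angles of `V` and `W` are uniquely determined. -/
theorem IsPrincipalSystem.unique {V W : Submodule 𝕜 X} {e f θ e' f' θ'}
    (h : IsPrincipalSystem V W e f θ) (h' : IsPrincipalSystem V W e' f' θ') : θ = θ' := by
  funext i
  have hpi := Real.pi_pos
  refine Real.injOn_cos ?_ ?_ ((h.cos_eq i).trans (h'.cos_eq i).symm)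
  · exact ⟨(h.mem_Icc i).1, by linarith [(h.mem_Icc i).2]⟩
  · exact ⟨(h'.mem_Icc i).1, by linarith [(h'.mem_Icc i).2]⟩

/-- The principal angles `θ 0 ≤ θ 1 ≤ ⋯` of `V` and `W`, read off from any pair of associated
principal bases; by `principalAngles_eq` the choice does not matter. -/
noncomputable def principalAngles (V W : Submodule 𝕜 X) :
    Fin (min (Module.finrank 𝕜 V) (Module.finrank 𝕜 W)) → ℝ :=
  (exists_isPrincipalSystem V W).choose

theorem principalAngles_eq {V W : Submodule 𝕜 X} {e f θ} (h : IsPrincipalSystem V W e f θ) :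
    principalAngles V W = θ := by
  obtain ⟨_, _, h'⟩ := (exists_isPrincipalSystem V W).choose_spec
  exact h'.unique h

open Classical in
/-- The (asymmetric) Grassmann angle of `V` with `W`. For nonzero subspaces with
`dim V ≤ dim W` its cosine is the product of the cosines of the principal angles, and it is `π / 2`
when `dim V > dim W`; the angle of the zero subspace with any subspace is `0`, and the angle of a
nonzero subspace with the zero subspace is `π / 2`. -/
noncomputable def grassmannAngle (V W : Submodule 𝕜 X) : ℝ :=
  if V = ⊥ then 0
  else if W = ⊥ then Real.pi / 2
  else if Module.finrank 𝕜 V ≤ Module.finrank 𝕜 W then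
    Real.arccos (∏ i, Real.cos (principalAngles V W i))
  else Real.pi / 2

end Submodule

/-!
The inequality is trivial unless `U ≠ ⊥` and `dim U ≤ dim V ≤ dim W`, because all Grassmann angles
lie in `[0, π / 2]`. In the remaining case let `p = dim U`. Orthonormal `p`-tuples `u`, `v` define
unit vectors in the `p`-th exterior power, with inner product `det ⟪u i, v j⟫`
(`inner_plueckerVector`, the Cauchy–Binet formula), and the angle
`arccos |det ⟪u i, v j⟫|` between the lines they span satisfies the triangle inequality
(`arccos_norm_det_inner_le_add`). The Grassmann angle of `U` with `V` is the smallest such angle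
between `U` and a `p`-tuple in `V`: it is attained at the principal bases, and
`grassmannAngle_le_arccos` gives minimality.

Let `v` be the `p`-tuple of `V` that attains the angle with `U`. Since the projection to `W`
shrinks a part of `V` no more than it shrinks all of `V`, there is a `p`-tuple `w` in `W` whose
angle with `v` is at most the Grassmann angle of `V` with `W` (`exists_orthonormal_arccos_le`, by
a Gram–Schmidt process that makes the matrix of inner products triangular). The triangle inequality
for `u`, `v`, `w` is then the claim.
-/

open Module

namespace Submodule

/-! ### Angles between decomposable multivectors -/

section PlueckerVector

variable {𝕜 E ι κ : Type*} [RCLike 𝕜] [NormedAddCommGroup E] [InnerProductSpace 𝕜 E]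
  [Fintype ι] [Fintype κ] [DecidableEq κ]

/-- The decomposable multivector `⋀ k, u k`, encoded by its coordinates with respect to an
orthonormal basis `x`: the minors of the coordinate matrix of `u`, indexed by *all* maps `κ → ι`
rather than by subsets of `ι`. Each minor is thus repeated (up to sign) `κ.card !` times, which the
factor `(√(κ.card !))⁻¹` compensates. -/
noncomputable def plueckerVector (x : OrthonormalBasis ι 𝕜 E) (u : κ → E) :
    EuclideanSpace 𝕜 (κ → ι) :=
  WithLp.toLp 2 fun s => (((√((Fintype.card κ).factorial : ℝ))⁻¹ : ℝ) : 𝕜) *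
    (Matrix.of fun i j => inner 𝕜 (x (s j)) (u i)).det

/-- The Cauchy–Binet formula: the inner product of two decomposable multivectors is the determinant
of the matrix of mutual inner products. -/
theorem inner_plueckerVector [DecidableEq ι] (x : OrthonormalBasis ι 𝕜 E) (u v : κ → E) :
    inner 𝕜 (plueckerVector x u) (plueckerVector x v) =
      (Matrix.of fun i j => inner 𝕜 (u i) (v j)).det := by
  have key : ∑ s : κ → ι, (starRingEnd 𝕜) (Matrix.of fun i j => inner 𝕜 (x (s j)) (u i)).det *
      (Matrix.of fun i j => inner 𝕜 (x (s j)) (v i)).det =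
      ((Fintype.card κ).factorial : 𝕜) * (Matrix.of fun i j => inner 𝕜 (u i) (v j)).det := by
    -- For a fixed permutation `τ` in the expansion of the second minor, the sum over all `s`
    -- is a determinant of inner products with permuted columns.
    have h1 : ∀ τ : Equiv.Perm κ, ∑ s : κ → ι,
        (starRingEnd 𝕜) (Matrix.of fun i j => inner 𝕜 (x (s j)) (u i)).det *
          ∏ i, inner 𝕜 (x (s i)) (v (τ i)) =
        (Matrix.of fun i j => inner 𝕜 (u i) (v (τ j))).det := by
      intro τ
      simp_rw [Matrix.det_apply', map_sum, Finset.sum_mul]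
      rw [Finset.sum_comm]
      refine Finset.sum_congr rfl fun σ _ => ?_
      simp only [Matrix.of_apply, map_mul, map_intCast, map_prod, inner_conj_symm, mul_assoc,
        ← Finset.mul_sum, ← Finset.prod_mul_distrib]
      rw [← Fintype.prod_sum (fun i k => inner 𝕜 (u (σ i)) (x k) * inner 𝕜 (x k) (v (τ i)))]
      simp_rw [x.sum_inner_mul_inner]
    have h2 : ∀ τ : Equiv.Perm κ, (Matrix.of fun i j => inner 𝕜 (u i) (v (τ j))).det =
        ((Equiv.Perm.sign τ : ℤ) : 𝕜) * (Matrix.of fun i j => inner 𝕜 (u i) (v j)).det := fun τ =>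
      Matrix.det_permute' τ (Matrix.of fun i j => inner 𝕜 (u i) (v j))
    have h3 : ∀ s : κ → ι, (Matrix.of fun i j => inner 𝕜 (x (s j)) (v i)).det =
        ∑ τ : Equiv.Perm κ, ((Equiv.Perm.sign τ : ℤ) : 𝕜) *
          ∏ i, inner 𝕜 (x (s i)) (v (τ i)) := fun s => Matrix.det_apply' _
    simp_rw [h3, Finset.mul_sum]
    rw [Finset.sum_comm]
    simp_rw [mul_left_comm _ ((_ : ℤ) : 𝕜), ← Finset.mul_sum, h1, h2, ← mul_assoc,
      ← Int.cast_mul, ← Units.val_mul, Int.units_mul_self]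
    simp [Fintype.card_perm]
  have hfac : (((√((Fintype.card κ).factorial : ℝ))⁻¹ : ℝ) : 𝕜) *
      (((√((Fintype.card κ).factorial : ℝ))⁻¹ : ℝ) : 𝕜) *
        ((Fintype.card κ).factorial : 𝕜) = 1 := by
    have h : (√((Fintype.card κ).factorial : ℝ))⁻¹ * (√((Fintype.card κ).factorial : ℝ))⁻¹ *
        ((Fintype.card κ).factorial : ℝ) = 1 := by
      rw [← mul_inv, Real.mul_self_sqrt (Nat.cast_nonneg _), inv_mul_cancel₀ (by positivity)]
    exact_mod_cast congrArg (fun t : ℝ => (t : 𝕜)) h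
  rw [PiLp.inner_apply]
  calc _ = (((√((Fintype.card κ).factorial : ℝ))⁻¹ : ℝ) : 𝕜) *
      (((√((Fintype.card κ).factorial : ℝ))⁻¹ : ℝ) : 𝕜) * ∑ s : κ → ι,
        (starRingEnd 𝕜) (Matrix.of fun i j => inner 𝕜 (x (s j)) (u i)).det *
          (Matrix.of fun i j => inner 𝕜 (x (s j)) (v i)).det := by
        rw [Finset.mul_sum]
        refine Finset.sum_congr rfl fun s _ => ?_
        simp only [plueckerVector, RCLike.inner_apply, map_mul, RCLike.conj_ofReal]
        ring
    _ = _ := by rw [key, ← mul_assoc, hfac, one_mul]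

theorem norm_plueckerVector [DecidableEq ι] (x : OrthonormalBasis ι 𝕜 E) {u : κ → E}
    (hu : Orthonormal 𝕜 u) : ‖plueckerVector x u‖ = 1 := by
  have h : (Matrix.of fun i j => inner 𝕜 (u i) (u j)) = 1 := by
    ext i j
    rw [Matrix.of_apply, orthonormal_iff_ite.mp hu, Matrix.one_apply]
  have h1 := inner_plueckerVector x u u
  rw [h, Matrix.det_one, inner_self_eq_norm_sq_to_K] at h1
  have h2 : ‖plueckerVector x u‖ ^ 2 = 1 := by exact_mod_cast h1
  exact (pow_eq_one_iff_of_nonneg (norm_nonneg _) two_ne_zero).mp h2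

end PlueckerVector

/-- The Fubini–Study distance between the lines spanned by unit vectors satisfies the triangle
inequality. -/
theorem arccos_norm_inner_le_add {𝕜 E : Type*} [RCLike 𝕜] [NormedAddCommGroup E]
    [InnerProductSpace 𝕜 E] {a b c : E} (ha : ‖a‖ = 1) (hb : ‖b‖ = 1) (hc : ‖c‖ = 1) :
    Real.arccos ‖inner 𝕜 a c‖ ≤ Real.arccos ‖inner 𝕜 a b‖ + Real.arccos ‖inner 𝕜 b c‖ := by
  let := InnerProductSpace.rclikeToReal 𝕜 E
  have phase : ∀ z : 𝕜, ∃ w : 𝕜, ‖w‖ = 1 ∧ w * z = (‖z‖ : 𝕜) := by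
    intro z
    obtain ⟨w, hw, h⟩ := RCLike.exists_norm_eq_mul_self z
    exact ⟨w, hw, h.symm⟩
  -- Change the phases of `a` and `c` so that their inner products with `b` are nonnegative reals.
  obtain ⟨α, hα, hα'⟩ := phase (inner 𝕜 b a)
  obtain ⟨γ, hγ, hγ'⟩ := phase (inner 𝕜 b c)
  have h := InnerProductGeometry.angle_le_angle_add_angle (α • a) b (γ • c)
  have e1 : inner ℝ (α • a) b = ‖inner 𝕜 a b‖ := by
    rw [real_inner_comm, real_inner_eq_re_inner 𝕜, inner_smul_right, hα', RCLike.ofReal_re,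
      norm_inner_symm]
  have e2 : inner ℝ b (γ • c) = ‖inner 𝕜 b c‖ := by
    rw [real_inner_eq_re_inner 𝕜, inner_smul_right, hγ', RCLike.ofReal_re]
  have e3 : inner ℝ (α • a) (γ • c) ≤ ‖inner 𝕜 a c‖ := by
    rw [real_inner_eq_re_inner 𝕜]
    refine (RCLike.re_le_norm _).trans ?_
    rw [inner_smul_left, inner_smul_right, norm_mul, norm_mul, RCLike.norm_conj, hα, hγ, one_mul,
      one_mul]
  simp only [InnerProductGeometry.angle, norm_smul, hα, hγ, ha, hb, hc, mul_one, div_one, e1,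
    e2] at h
  exact (Real.arccos_le_arccos e3).trans h

variable {𝕜 X : Type*} [RCLike 𝕜] [NormedAddCommGroup X] [InnerProductSpace 𝕜 X]

theorem norm_det_inner_le_one [FiniteDimensional 𝕜 X] {κ : Type*} [Fintype κ] [DecidableEq κ]
    {u v : κ → X} (hu : Orthonormal 𝕜 u) (hv : Orthonormal 𝕜 v) :
    ‖(Matrix.of fun i j => inner 𝕜 (u i) (v j)).det‖ ≤ 1 := by
  rw [← inner_plueckerVector (stdOrthonormalBasis 𝕜 X)]
  refine (norm_inner_le_norm _ _).trans ?_
  rw [norm_plueckerVector _ hu, norm_plueckerVector _ hv, one_mul]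

/-- The lines spanned by the decomposable multivectors of orthonormal families satisfy the triangle
inequality. -/
theorem arccos_norm_det_inner_le_add [FiniteDimensional 𝕜 X] {κ : Type*} [Fintype κ]
    [DecidableEq κ] {u v w : κ → X}
    (hu : Orthonormal 𝕜 u) (hv : Orthonormal 𝕜 v) (hw : Orthonormal 𝕜 w) :
    Real.arccos ‖(Matrix.of fun i j => inner 𝕜 (u i) (w j)).det‖ ≤
      Real.arccos ‖(Matrix.of fun i j => inner 𝕜 (u i) (v j)).det‖ +
        Real.arccos ‖(Matrix.of fun i j => inner 𝕜 (v i) (w j)).det‖ := by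
  have x := stdOrthonormalBasis 𝕜 X
  simp only [← inner_plueckerVector x]
  exact arccos_norm_inner_le_add (norm_plueckerVector x hu) (norm_plueckerVector x hv)
    (norm_plueckerVector x hw)

theorem norm_det_inner_orthonormalBasis {E κ : Type*} [NormedAddCommGroup E]
    [InnerProductSpace 𝕜 E] [Fintype κ] [DecidableEq κ] (a b : OrthonormalBasis κ 𝕜 E) :
    ‖(Matrix.of fun i j => inner 𝕜 (a i) (b j)).det‖ = 1 := by
  rw [← a.det_to_matrix_orthonormalBasis b, Basis.det_apply]
  congr 2
  ext i j
  simp [Basis.toMatrix_apply, a.repr_apply_apply]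

theorem orthonormal_coe {V : Submodule 𝕜 X} {κ : Type*} {v : κ → V} (hv : Orthonormal 𝕜 v) :
    Orthonormal 𝕜 fun i => (v i : X) :=
  hv.comp_linearIsometry V.subtypeₗᵢ

/-! ### Grassmann angles and principal bases -/

section PrincipalBases

variable [FiniteDimensional 𝕜 X] {U V W : Submodule 𝕜 X}

/-- Principal bases in the case `dim V ≤ dim W`, with the cosines `c` indexed by `Fin (dim V)`.
The second property says that the orthogonal projection onto `W` maps `e i` to `c i • f i`. -/
theorem exists_principal_cosines (hV : V ≠ ⊥) (h : finrank 𝕜 V ≤ finrank 𝕜 W) :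
    ∃ (e : OrthonormalBasis (Fin (finrank 𝕜 V)) 𝕜 V) (f : OrthonormalBasis (Fin (finrank 𝕜 W)) 𝕜 W)
      (c : Fin (finrank 𝕜 V) → ℝ), (∀ i, 0 ≤ c i) ∧
      (∀ i, ∀ w : W, inner 𝕜 (e i : X) (w : X) = (c i : 𝕜) * inner 𝕜 (f (Fin.castLE h i)) w) ∧
      grassmannAngle V W = Real.arccos (∏ i, c i) := by
  obtain ⟨θ, e, f, hs⟩ := exists_isPrincipalSystem V W
  have hm : min (finrank 𝕜 V) (finrank 𝕜 W) = finrank 𝕜 V := min_eq_left h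
  refine ⟨e, f, fun i => Real.cos (θ (Fin.cast hm.symm i)), fun i => ?_, fun i w => ?_, ?_⟩
  · have := hs.mem_Icc (Fin.cast hm.symm i)
    exact Real.cos_nonneg_of_mem_Icc ⟨by linarith [this.1, Real.pi_pos], this.2⟩
  · conv_lhs => rw [← f.sum_repr' w]
    rw [coe_sum, inner_sum, Finset.sum_eq_single (Fin.castLE h i)]
    · rw [coe_smul, inner_smul_right, hs.inner_eq, dif_pos (by simp), mul_comm]
      rfl
    · intro j _ hj
      rw [coe_smul, inner_smul_right, hs.inner_eq, dif_neg, mul_zero]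
      exact fun hij => hj (Fin.ext hij.symm)
    · simp
  · have hW : W ≠ ⊥ := by
      rintro rfl
      rw [finrank_bot, Nat.le_zero, finrank_eq_zero] at h
      exact hV h
    rw [grassmannAngle, if_neg hV, if_neg hW, if_pos h, principalAngles_eq hs]
    congr 1
    exact (Fintype.prod_equiv (finCongr hm.symm) _ _ fun i => rfl).symm

theorem grassmannAngle_eq_pi_div_two (h : finrank 𝕜 W < finrank 𝕜 V) :
    grassmannAngle V W = Real.pi / 2 := by
  have hV : V ≠ ⊥ := by
    rintro rfl
    simp at h
  rw [grassmannAngle, if_neg hV, if_neg h.not_ge, ite_self]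

theorem grassmannAngle_nonneg : 0 ≤ grassmannAngle V W := by
  have := Real.pi_pos
  rw [grassmannAngle]
  split_ifs
  · exact le_rfl
  · positivity
  · exact Real.arccos_nonneg _
  · positivity

theorem grassmannAngle_le_pi_div_two : grassmannAngle V W ≤ Real.pi / 2 := by
  have := Real.pi_pos
  by_cases hV : V = ⊥
  · rw [grassmannAngle, if_pos hV]
    positivity
  · rcases le_or_gt (finrank 𝕜 V) (finrank 𝕜 W) with h | h
    · obtain ⟨e, f, c, hc, -, hΘ⟩ := exists_principal_cosines hV h
      rw [hΘ, Real.arccos_le_pi_div_two]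
      exact Finset.prod_nonneg fun i _ => hc i
    · exact (grassmannAngle_eq_pi_div_two h).le

/-- Among all orthonormal families of `W` of length `dim V`, the one in the principal basis makes
the smallest angle with `V`. -/
theorem grassmannAngle_le_arccos (hV : V ≠ ⊥) (h : finrank 𝕜 V ≤ finrank 𝕜 W)
    (b : OrthonormalBasis (Fin (finrank 𝕜 V)) 𝕜 V) {w : Fin (finrank 𝕜 V) → W}
    (hw : Orthonormal 𝕜 w) :
    grassmannAngle V W ≤
      Real.arccos ‖(Matrix.of fun i j => inner 𝕜 (b i : X) (w j : X)).det‖ := by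
  obtain ⟨e, f, c, hc, hcf, hΘ⟩ := exists_principal_cosines hV h
  rw [hΘ]
  refine Real.arccos_le_arccos ?_
  have hf : Orthonormal 𝕜 fun i => f (Fin.castLE h i) :=
    f.orthonormal.comp _ (Fin.castLE_injective h)
  have hfac : (Matrix.of fun i j => inner 𝕜 (b i : X) (w j : X)) =
      (Matrix.of fun i k => inner 𝕜 (b i) (e k)) * Matrix.diagonal (fun k => (c k : 𝕜)) *
        (Matrix.of fun k j => inner 𝕜 (f (Fin.castLE h k)) (w j)) := by
    ext i j
    rw [Matrix.mul_apply, Matrix.of_apply]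
    conv_lhs => rw [← e.sum_repr' (b i)]
    rw [coe_sum, sum_inner]
    refine Finset.sum_congr rfl fun k _ => ?_
    rw [coe_smul, inner_smul_left, hcf, inner_conj_symm, Matrix.mul_diagonal, mul_assoc]
    rfl
  rw [hfac, Matrix.det_mul, Matrix.det_mul, norm_mul, norm_mul, norm_det_inner_orthonormalBasis,
    one_mul, Matrix.det_diagonal, ← RCLike.ofReal_prod, RCLike.norm_ofReal,
    abs_of_nonneg (Finset.prod_nonneg fun i _ => hc i)]
  exact mul_le_of_le_one_right (Finset.prod_nonneg fun i _ => hc i) (norm_det_inner_le_one hf hw)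

/-- For every initial segment of an orthonormal basis `b` of `V` there is an orthonormal family in
`W` at an angle of at most `grassmannAngle V W`. This is the monotonicity of the Grassmann angle in
its first argument. -/
theorem exists_orthonormal_arccos_le (hV : V ≠ ⊥) (h : finrank 𝕜 V ≤ finrank 𝕜 W)
    (b : OrthonormalBasis (Fin (finrank 𝕜 V)) 𝕜 V) {p : ℕ} (hp : p ≤ finrank 𝕜 V) :
    ∃ w : Fin p → W, Orthonormal 𝕜 w ∧
      Real.arccos ‖(Matrix.of fun i j => inner 𝕜 (b (Fin.castLE hp i) : X) (w j : X)).det‖ ≤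
        grassmannAngle V W := by
  obtain ⟨e, f, c, hc, hcf, hΘ⟩ := exists_principal_cosines hV h
  have hf : Orthonormal 𝕜 fun i => f (Fin.castLE h i) :=
    f.orthonormal.comp _ (Fin.castLE_injective h)
  -- `Q : V → W` is the isometry with `e i ↦ f i`, so that the projection of `V` to `W` is `Q`
  -- after the self-adjoint map `e i ↦ c i • e i`. The vectors `d i` are the images of the `b i`
  -- under this self-adjoint map.
  let Q : V →ₗ[𝕜] W := e.toBasis.constr 𝕜 fun i => f (Fin.castLE h i)
  have hQe : ∀ k, Q (e k) = f (Fin.castLE h k) := fun k => by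
    have := e.toBasis.constr_basis 𝕜 (fun i => f (Fin.castLE h i)) k
    rwa [e.coe_toBasis] at this
  let Q' : V →ₗᵢ[𝕜] W := Q.isometryOfOrthonormal (v := e.toBasis)
    (by rw [e.coe_toBasis]; exact e.orthonormal)
    (by
      have : (Q ∘ e.toBasis) = fun i => f (Fin.castLE h i) := by
        rw [e.coe_toBasis]; exact funext hQe
      rw [this]; exact hf)
  have hQ'e : ∀ k, Q' (e k) = f (Fin.castLE h k) := hQe
  let d : Fin (finrank 𝕜 V) → V := fun i => ∑ k, ((c k : 𝕜) * inner 𝕜 (e k) (b i)) • e k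
  have hd : ∀ i z, inner 𝕜 (b i : X) (Q' z : X) = inner 𝕜 (d i) z := by
    intro i z
    conv_lhs => rw [← e.sum_repr' (b i)]
    rw [coe_sum, sum_inner, sum_inner]
    refine Finset.sum_congr rfl fun k _ => ?_
    rw [coe_smul, inner_smul_left, hcf, ← hQ'e, Q'.inner_map_map, inner_smul_left, map_mul,
      RCLike.conj_ofReal]
    ring
  -- Orthonormalizing the `d i` makes the matrix of inner products triangular, so that its leading
  -- minors are products of diagonal entries, all of absolute value at most `1`.
  let g := InnerProductSpace.gramSchmidtOrthonormalBasis (𝕜 := 𝕜) (E := V) (by simp) d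
  have hM : ∀ i j, i < j → inner 𝕜 (b i : X) (Q' (g j) : X) = 0 := by
    intro i j hij
    rw [hd, ← inner_conj_symm,
      InnerProductSpace.gramSchmidtOrthonormalBasis_inv_triangular _ d hij, map_zero]
  have hle : ∀ i, ‖inner 𝕜 (b i : X) (Q' (g i) : X)‖ ≤ 1 := by
    intro i
    refine (norm_inner_le_norm _ _).trans ?_
    have hb : ‖(b i : X)‖ = 1 := b.orthonormal.1 i
    have hg : ‖(Q' (g i) : X)‖ = 1 := (Q'.norm_map (g i)).trans (g.orthonormal.1 i)
    rw [hb, hg, one_mul]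
  have hdet : ∏ i, c i = ∏ i, ‖inner 𝕜 (b i : X) (Q' (g i) : X)‖ := by
    have hfac : (Matrix.of fun i j => inner 𝕜 (b i : X) (Q' (g j) : X)) =
        (Matrix.of fun i k => inner 𝕜 (b i) (e k)) * Matrix.diagonal (fun k => (c k : 𝕜)) *
          (Matrix.of fun k j => inner 𝕜 (e k) (g j)) := by
      ext i j
      rw [Matrix.mul_apply, Matrix.of_apply, hd, sum_inner]
      refine Finset.sum_congr rfl fun k _ => ?_
      rw [inner_smul_left, map_mul, RCLike.conj_ofReal, inner_conj_symm, Matrix.mul_diagonal,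
        Matrix.of_apply, Matrix.of_apply, mul_comm (c k : 𝕜)]
    have htri := Matrix.det_of_isLowerTriangular
      (Matrix.of fun i j => inner 𝕜 (b i : X) (Q' (g j) : X)) fun i j hij => hM i j hij
    simp only [Matrix.of_apply] at htri
    rw [← norm_prod, ← htri, hfac, Matrix.det_mul, Matrix.det_mul, norm_mul, norm_mul,
      norm_det_inner_orthonormalBasis, norm_det_inner_orthonormalBasis, one_mul, mul_one, Matrix.det_diagonal,
      ← RCLike.ofReal_prod, RCLike.norm_ofReal, abs_of_nonneg (Finset.prod_nonneg fun i _ => hc i)]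
  refine ⟨fun j => Q' (g (Fin.castLE hp j)),
    (g.orthonormal.comp _ (Fin.castLE_injective hp)).comp_linearIsometry Q', ?_⟩
  rw [hΘ]
  refine Real.arccos_le_arccos ?_
  have htri := Matrix.det_of_isLowerTriangular
    (Matrix.of fun i j => inner 𝕜 (b (Fin.castLE hp i) : X) (Q' (g (Fin.castLE hp j)) : X))
    fun i j hij => hM (Fin.castLE hp i) (Fin.castLE hp j) hij
  rw [htri, hdet, norm_prod]
  calc ∏ i, ‖inner 𝕜 (b i : X) (Q' (g i) : X)‖
      ≤ ∏ i ∈ Finset.univ.map (Fin.castLEEmb hp), ‖inner 𝕜 (b i : X) (Q' (g i) : X)‖ :=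
        Finset.prod_le_prod_of_subset_of_le_one (Finset.subset_univ _)
          (fun _ _ => norm_nonneg _) fun i _ _ => hle i
    _ = _ := by
        rw [Finset.prod_map]
        rfl

end PrincipalBases

end Submodule

theorem mainTheorem1 {𝕜 X : Type*} [RCLike 𝕜] [NormedAddCommGroup X] [InnerProductSpace 𝕜 X]
    [FiniteDimensional 𝕜 X] (U V W : Submodule 𝕜 X) :
    Submodule.grassmannAngle U W ≤
      Submodule.grassmannAngle U V + Submodule.grassmannAngle V W := by
  have h0 : ∀ A B : Submodule 𝕜 X, 0 ≤ A.grassmannAngle B := fun _ _ =>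
    Submodule.grassmannAngle_nonneg
  have h1 : U.grassmannAngle W ≤ Real.pi / 2 := Submodule.grassmannAngle_le_pi_div_two
  by_cases hU : U = ⊥
  · have : U.grassmannAngle W = 0 := by rw [Submodule.grassmannAngle, if_pos hU]
    rw [this]
    exact add_nonneg (h0 _ _) (h0 _ _)
  rcases lt_or_ge (finrank 𝕜 V) (finrank 𝕜 U) with hUV | hUV
  · linarith [Submodule.grassmannAngle_eq_pi_div_two hUV, h0 V W]
  rcases lt_or_ge (finrank 𝕜 W) (finrank 𝕜 V) with hVW | hVW
  · linarith [Submodule.grassmannAngle_eq_pi_div_two hVW, h0 U V]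
  have hV : V ≠ ⊥ := by
    rintro rfl
    rw [finrank_bot, Nat.le_zero, Submodule.finrank_eq_zero] at hUV
    exact hU hUV
  -- `v` spans the subspace of `V` closest to `U`, and `w` one of `W` close to the span of `v`.
  obtain ⟨e, f, c, hc, hcf, hΘ⟩ := Submodule.exists_principal_cosines hU hUV
  have hv : Orthonormal 𝕜 fun i => f (Fin.castLE hUV i) :=
    f.orthonormal.comp _ (Fin.castLE_injective hUV)
  obtain ⟨w, hw, hvw⟩ := Submodule.exists_orthonormal_arccos_le hV hVW f hUV
  have huv : (Matrix.of fun i j => inner 𝕜 (e i : X) (f (Fin.castLE hUV j) : X)) =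
      Matrix.diagonal fun i => (c i : 𝕜) := by
    ext i j
    have hij := orthonormal_iff_ite.mp hv i j
    rw [Matrix.of_apply, hcf, hij, Matrix.diagonal_apply, mul_ite,
      mul_one, mul_zero]
  have hUV' : U.grassmannAngle V =
      Real.arccos ‖(Matrix.of fun i j => inner 𝕜 (e i : X) (f (Fin.castLE hUV j) : X)).det‖ := by
    rw [hΘ, huv, Matrix.det_diagonal, ← RCLike.ofReal_prod, RCLike.norm_ofReal,
      abs_of_nonneg (Finset.prod_nonneg fun i _ => hc i)]
  calc U.grassmannAngle W
      ≤ Real.arccos ‖(Matrix.of fun i j => inner 𝕜 (e i : X) (w j : X)).det‖ :=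
        Submodule.grassmannAngle_le_arccos hU (hUV.trans hVW) e hw
    _ ≤ _ := Submodule.arccos_norm_det_inner_le_add (Submodule.orthonormal_coe e.orthonormal)
        (Submodule.orthonormal_coe hv) (Submodule.orthonormal_coe hw)
    _ ≤ U.grassmannAngle V + V.grassmannAngle W := by
        rw [hUV']
        exact add_le_add le_rfl hvw
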